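/- Let $\mathfrak g$ be a (finite-dimensional) simple complex Lie algebra, let $G$ be the simple connected simply connected complex Lie group with Lie algebra $\mathfrak g$, and let $\mathfrak k\subset\mathfrak g$ be a fixed compact real form, that is, a real Lie subalgebra with $\mathfrak g=\mathfrak k\oplus i\mathfrak k$ on which the Killing form is negative definite. Let $\mathcal O=\mathrm{Ad}(G)e_0\subset\mathfrak g$ be a nonzero nilpotent orbit ($e_0\neq 0$ and $\mathrm{ad}(e_0)$ nilpotent). The height $\mathrm{ht}(\mathcal O)$ is the maximal integer $k$ such that $\mathrm{ad}(e)^k\ne 0$ for $e\in\mathcal O$ (it does not depend on the choice of $e$). An $\mathfrak{sl}_2$-triple is a triple $\langle e,h,f\rangle$ of elements of $\mathfrak g$ with $[e,f]=h$, $[h,e]=2e$, $[h,f]=-2f$. The orbit $\mathcal O$ is called a Moore–Penrose orbit if for every $e\in\mathcal O$ there is an $\mathfrak{sl}_2$-triple $\langle e,h,f\rangle$ with $h\in i\mathfrak k$. Then $\mathcal O$ is a Moore–Penrose orbit if and only if $\mathrm{ht}(\mathcal O)=2$. In this case, for every $e\in\mathcal O$ there exists a unique $\mathfrak{sl}_2$-triple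 $\langle e,h,f\rangle$ with $h\in i\mathfrak k$. -/

import Mathlib

open scoped Pointwise

noncomputable section

/-- The adjoint group `Ad(G) ⊆ GL(𝔤)` of a connected complex Lie group `G` with finite-dimensional
Lie algebra `𝔤`: the group generated by the operators `exp (ad x)`, `x ∈ 𝔤` (recall that
`Ad (exp x) = exp (ad x)` and that a connected Lie group is generated by the image of `exp`).
That `φ` is `exp (ad x)` is written out: `φ` is the sum of the exponential series of `ad x`, for the
canonical topology of the finite-dimensional complex vector space `End 𝔤`. -/
def adjointGroup (𝔤 : Type*) [LieRing 𝔤] [LieAlgebra ℂ 𝔤] : Subgroup (𝔤 ≃ₗ[ℂ] 𝔤) :=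
  letI : TopologicalSpace (Module.End ℂ 𝔤) := moduleTopology ℂ (Module.End ℂ 𝔤)
  Subgroup.closure
    {φ | ∃ x : 𝔤, HasSum (fun n : ℕ => (n.factorial : ℂ)⁻¹ • LieAlgebra.ad ℂ 𝔤 x ^ n)
      (φ : Module.End ℂ 𝔤)}

/-- A nilpotent orbit: the orbit `Ad(G) e` of an `ad`-nilpotent element `e`. -/
def IsNilpotentOrbit {𝔤 : Type*} [LieRing 𝔤] [LieAlgebra ℂ 𝔤] (O : Set 𝔤) : Prop :=
  ∃ e : 𝔤, IsNilpotent (LieAlgebra.ad ℂ 𝔤 e) ∧ O = MulAction.orbit (adjointGroup 𝔤) e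

/-- The height of a nilpotent orbit: the maximal `k` such that `ad(e) ^ k ≠ 0` for `e` in the orbit
(`k` does not depend on the choice of `e`). -/
def orbitHeight {𝔤 : Type*} [LieRing 𝔤] [LieAlgebra ℂ 𝔤] (O : Set 𝔤) : ℕ :=
  sSup {k : ℕ | ∃ e ∈ O, LieAlgebra.ad ℂ 𝔤 e ^ k ≠ 0}

/-- A compact real form `𝔨` of a semisimple complex Lie algebra `𝔤`: a real Lie subalgebra
with `𝔤 = 𝔨 ⊕ i𝔨` on which the Killing form is negative definite. (The Killing form of `𝔤` is
real-valued on a real form, where it agrees with the Killing form of that real form.) -/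
structure IsCompactRealForm {𝔤 : Type*} [LieRing 𝔤] [LieAlgebra ℂ 𝔤]
    (𝔨 : Submodule ℝ 𝔤) : Prop where
  lie_mem : ∀ x ∈ 𝔨, ∀ y ∈ 𝔨, ⁅x, y⁆ ∈ 𝔨
  isCompl : IsCompl 𝔨 (Complex.I • 𝔨)
  neg_def : ∀ x ∈ 𝔨, x ≠ 0 → (killingForm ℂ 𝔤 x x).re < 0

/-- The orbit `O` is a Moore–Penrose orbit with respect to the compact real form `𝔨`: every `e ∈ O`
lies in an `sl₂`-triple `⟨e, h, f⟩` with `h ∈ i𝔨`. (The condition `h ≠ 0` in `IsSl2Triple` follows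
from the relation `[h, e] = 2e` as soon as `e ≠ 0`.) -/
def IsMoorePenroseOrbit {𝔤 : Type*} [LieRing 𝔤] [LieAlgebra ℂ 𝔤]
    (𝔨 : Submodule ℝ 𝔤) (O : Set 𝔤) : Prop :=
  ∀ e ∈ O, ∃ h f : 𝔤, IsSl2Triple h e f ∧ h ∈ Complex.I • 𝔨

end

/-! ### Exponentials of `ad x` and the adjoint group -/

section Exponential

variable {𝔤 : Type*} [LieRing 𝔤] [LieAlgebra ℂ 𝔤]

/-! Write σ for the conjugation along 𝔨 and K for the Killing form. No nonzero element of i𝔨 is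
isotropic for K, while two characteristics of e differ by an element of ker (ad e) ∩ im (ad e),
which is isotropic. Hence uniqueness (`IsSl2Triple.eq_of_mem_I_smul`).

Let (ad e)³ = 0. Among the h ∈ im (ad e) with [h, e] = 2e, take the one of least norm for -K(x, σx);
then σh ∈ ker (ad e) + im (ad e). Morozov's lemma completes h to a triple. Both ker (ad e) and im
(ad e) have only weights 0, 1, 2, so [h, σh] has positive weights and is isotropic; it also lies in
i𝔨, so h and σh commute. Since ad h is diagonalizable with real eigenvalues, positivity of the
Hermitian form forces σh = -h (`exists_isSl2Triple_mem_I_smul`).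

Conversely, suppose n ≥ 3 is maximal with (ad e)ⁿ ≠ 0. Take u ≠ 0 in im (ad e)ⁿ and x = [f, u], of
weight n - 2 > 0; x lies in im (ad e) but not in ker (ad e). Moving e by g = exp (ad x) moves h by a
multiple of x, and isotropy shows that a Hermitian characteristic of g e must equal h. This forces x
∈ ker (ad e), a contradiction (`IsMoorePenroseOrbit.ad_pow_three_eq_zero`). -/

lemma ad_pow_lie_factorial (x a b : 𝔤) (n : ℕ) :
    (n.factorial : ℂ)⁻¹ • (LieAlgebra.ad ℂ 𝔤 x ^ n) ⁅a, b⁆ =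
      ∑ kl ∈ Finset.HasAntidiagonal.antidiagonal n,
        ⁅(kl.1.factorial : ℂ)⁻¹ • (LieAlgebra.ad ℂ 𝔤 x ^ kl.1) a,
          (kl.2.factorial : ℂ)⁻¹ • (LieAlgebra.ad ℂ 𝔤 x ^ kl.2) b⁆ := by
  rw [LieAlgebra.ad_pow_lie, Finset.smul_sum]
  refine Finset.sum_congr rfl fun kl hkl => ?_
  obtain rfl := Finset.HasAntidiagonal.mem_antidiagonal.mp hkl
  rw [smul_lie, lie_smul, ← Nat.cast_smul_eq_nsmul ℂ, smul_smul, smul_smul]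
  congr 1
  have h1 : ((kl.1 + kl.2).factorial : ℂ) ≠ 0 := by exact_mod_cast Nat.factorial_ne_zero _
  have h2 : (kl.1.factorial : ℂ) ≠ 0 := by exact_mod_cast Nat.factorial_ne_zero _
  have h3 : (kl.2.factorial : ℂ) ≠ 0 := by exact_mod_cast Nat.factorial_ne_zero _
  have h4 : ((kl.1 + kl.2).choose kl.1 : ℂ) * kl.1.factorial * kl.2.factorial
      = (kl.1 + kl.2).factorial := by
    rw [Nat.choose_symm_add]
    exact_mod_cast Nat.add_choose_mul_factorial_mul_factorial kl.1 kl.2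
  field_simp
  linear_combination h4

lemma exists_mem_adjointGroup_exp {x : 𝔤} {n : ℕ} (hn : LieAlgebra.ad ℂ 𝔤 x ^ n = 0) :
    ∃ g ∈ adjointGroup 𝔤, ∀ c, g c = ∑ i ∈ Finset.range n,
      (i.factorial : ℂ)⁻¹ • (LieAlgebra.ad ℂ 𝔤 x ^ i) c := by
  let _ : Algebra ℚ (Module.End ℂ 𝔤) := Algebra.compHom _ (algebraMap ℚ ℂ)
  let _ : TopologicalSpace (Module.End ℂ 𝔤) := moduleTopology ℂ (Module.End ℂ 𝔤)
  have hnil : IsNilpotent (LieAlgebra.ad ℂ 𝔤 x) := ⟨n, hn⟩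
  have h := IsNilpotent.exp_eq_sum hn
  have hsmul : ∀ (q : ℚ) (T : Module.End ℂ 𝔤), q • T = (q : ℂ) • T := fun _ _ => rfl
  simp only [hsmul, Rat.cast_inv, Rat.cast_natCast] at h
  let g : 𝔤 ≃ₗ[ℂ] 𝔤 := LinearEquiv.ofLinearMap (IsNilpotent.exp (LieAlgebra.ad ℂ 𝔤 x))
    (IsNilpotent.exp (-LieAlgebra.ad ℂ 𝔤 x)) (IsNilpotent.exp_mul_exp_neg_self hnil)
    (IsNilpotent.exp_neg_mul_exp_self hnil)
  have hg : (g : Module.End ℂ 𝔤) = IsNilpotent.exp (LieAlgebra.ad ℂ 𝔤 x) := rfl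
  refine ⟨g, Subgroup.subset_closure ⟨x, ?_⟩, fun c => ?_⟩
  · rw [hg, h]
    refine hasSum_sum_of_ne_finset_zero fun i hi => ?_
    rw [pow_eq_zero_of_le (by simpa using hi) hn, smul_zero]
  · change IsNilpotent.exp (LieAlgebra.ad ℂ 𝔤 x) c = _
    rw [h]
    simp

variable [FiniteDimensional ℂ 𝔤]

/-- The operator `exp (ad x)` is an automorphism of the Lie algebra. -/
lemma map_lie_of_hasSum_exp {x : 𝔤} {φ : Module.End ℂ 𝔤}
    (hφ : ∀ l : Module.End ℂ 𝔤 →ₗ[ℂ] ℂ,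
      HasSum (fun n : ℕ => l ((n.factorial : ℂ)⁻¹ • LieAlgebra.ad ℂ 𝔤 x ^ n)) (l φ))
    (a b : 𝔤) : φ ⁅a, b⁆ = ⁅φ a, φ b⁆ := by
  set s : ℕ → 𝔤 → 𝔤 := fun n c => (n.factorial : ℂ)⁻¹ • (LieAlgebra.ad ℂ 𝔤 x ^ n) c with hs
  have key : ∀ (m : 𝔤 →ₗ[ℂ] ℂ) (c : 𝔤), HasSum (fun n => m (s n c)) (m (φ c)) := fun m c => by
    simpa [hs] using hφ (m ∘ₗ LinearMap.applyₗ c)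
  let v := Module.finBasis ℂ 𝔤
  -- In coordinates the bracket is a polynomial in scalar series, so the claim reduces to Cauchy
  -- products in ℂ and no norm on 𝔤 is needed.
  have expand : ∀ (m : 𝔤 →ₗ[ℂ] ℂ) (c d : 𝔤),
      m ⁅c, d⁆ = ∑ i, ∑ j, v.coord i c * v.coord j d * m ⁅v i, v j⁆ := by
    intro m c d
    conv_lhs => rw [← v.sum_repr c, ← v.sum_repr d]
    rw [sum_lie_sum]
    simp [mul_assoc, mul_left_comm]
  refine v.ext_elem fun m => ?_
  have h1 := key (v.coord m) ⁅a, b⁆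
  have h2 : HasSum (fun n => v.coord m (s n ⁅a, b⁆)) (v.coord m ⁅φ a, φ b⁆) := by
    rw [expand]
    have : (fun n => v.coord m (s n ⁅a, b⁆)) = fun n => ∑ i, ∑ j,
        (∑ kl ∈ Finset.HasAntidiagonal.antidiagonal n, v.coord i (s kl.1 a) * v.coord j (s kl.2 b)) *
          v.coord m ⁅v i, v j⁆ := by
      funext n
      have hn : s n ⁅a, b⁆ = ∑ kl ∈ Finset.HasAntidiagonal.antidiagonal n,
          ⁅s kl.1 a, s kl.2 b⁆ := ad_pow_lie_factorial x a b n
      rw [hn, map_sum, Finset.sum_congr rfl fun kl _ => expand (v.coord m) (s kl.1 a) (s kl.2 b)]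
      simp only [Finset.sum_mul]
      rw [Finset.sum_comm]
      refine Finset.sum_congr rfl fun i _ => ?_
      rw [Finset.sum_comm]
    rw [this]
    refine hasSum_sum fun i _ => hasSum_sum fun j _ => HasSum.mul_right _ ?_
    have hi := key (v.coord i) a
    have hj := key (v.coord j) b
    rw [← hi.tsum_eq, ← hj.tsum_eq, tsum_mul_tsum_eq_tsum_sum_antidiagonal_of_summable_norm
      hi.summable.norm hj.summable.norm]
    exact (summable_norm_sum_mul_antidiagonal_of_summable_norm
      hi.summable.norm hj.summable.norm).of_norm.hasSum
  exact h1.unique h2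

lemma adjointGroup_map_lie {g : 𝔤 ≃ₗ[ℂ] 𝔤} (hg : g ∈ adjointGroup 𝔤) (a b : 𝔤) :
    g ⁅a, b⁆ = ⁅g a, g b⁆ := by
  let _ : TopologicalSpace (Module.End ℂ 𝔤) := moduleTopology ℂ (Module.End ℂ 𝔤)
  have _ : IsModuleTopology ℂ (Module.End ℂ 𝔤) := ⟨rfl⟩
  induction hg using Subgroup.closure_induction generalizing a b with
  | mem φ h =>
    obtain ⟨x, hx⟩ := h
    refine map_lie_of_hasSum_exp (x := x) (φ := (φ : Module.End ℂ 𝔤)) (fun l => ?_) a b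
    exact hx.map l (IsModuleTopology.continuous_of_linearMap l)
  | one => rfl
  | mul g₁ g₂ _ _ h₁ h₂ => simp [LinearEquiv.mul_apply, h₁, h₂]
  | inv g _ h =>
    apply g.injective
    have e : ∀ c, g (g⁻¹ c) = c := fun c => g.apply_symm_apply c
    rw [h, e, e, e]

end Exponential

/-- Each nonzero power X ^ j is an eigenvector of the commutator with H, of eigenvalue j * k; only
finitely many eigenvalues are available. -/
lemma Module.End.isNilpotent_of_commutator_eq_smul {V : Type*} [AddCommGroup V] [Module ℂ V]
    [FiniteDimensional ℂ V] {H X : Module.End ℂ V} {k : ℂ} (hk : k ≠ 0)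
    (h : H * X - X * H = k • X) : IsNilpotent X := by
  by_contra hX
  have hX' : ∀ j : ℕ, X ^ j ≠ 0 := fun j hj => hX ⟨j, hj⟩
  let T : Module.End ℂ (Module.End ℂ V) := LinearMap.mulLeft ℂ H - LinearMap.mulRight ℂ H
  have hT : ∀ j : ℕ, H * X ^ j - X ^ j * H = (j * k) • X ^ j := by
    intro j
    induction j with
    | zero => simp
    | succ j ih =>
      have : H * X ^ (j + 1) - X ^ (j + 1) * H
          = (H * X ^ j - X ^ j * H) * X + X ^ j * (H * X - X * H) := by
        rw [pow_succ]; noncomm_ring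
      rw [this, ih, h, smul_mul_assoc, mul_smul_comm, ← pow_succ, ← add_smul]
      push_cast
      ring_nf
  have hev : ∀ j : ℕ, T.HasEigenvalue (j * k) := fun j =>
    Module.End.hasEigenvalue_of_hasEigenvector
      (Module.End.hasEigenvector_iff.mpr
        ⟨Module.End.mem_eigenspace_iff.mpr (by simpa [T] using hT j), hX' j⟩)
  have hinj : Function.Injective fun j : ℕ => (j * k : ℂ) := fun i j hij => by
    simpa [hk] using hij
  exact (Set.infinite_range_of_injective hinj).mono (by rintro _ ⟨j, rfl⟩; exact hev j)
    (Module.End.finite_hasEigenvalue T)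

/-! ### Associative identities for sl₂-relations with E ^ 3 = 0 -/

section Ring

variable {A : Type*} [Ring A] {E H F : A}

lemma pow_succ_mul_of_sl2_relations (hEF : E * F - F * E = H) (hHE : H * E - E * H = 2 * E)
    (n : ℕ) : E ^ (n + 1) * F - F * E ^ (n + 1) = (n + 1) * (H - n) * E ^ n := by
  induction n with
  | zero => simpa using hEF
  | succ n ih =>
    have h1 : E * H = (H - 2) * E := by linear_combination (norm := noncomm_ring) -hHE
    have hc := Nat.cast_commute n E
    have hc1 : E * (n + 1) = (n + 1) * E := by rw [mul_add, add_mul, hc.eq]; simp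
    have h2 : E * ((n + 1) * (H - n) * E ^ n) = (n + 1) * (H - 2 - n) * E ^ (n + 1) := by
      rw [← mul_assoc, ← mul_assoc, hc1, mul_assoc (n + 1 : A) E, mul_sub, h1, ← hc.eq,
        ← sub_mul, pow_succ' E n]
      noncomm_ring
    have h3 : E ^ (n + 2) * F - F * E ^ (n + 2) =
        E * (E ^ (n + 1) * F - F * E ^ (n + 1)) + (E * F - F * E) * E ^ (n + 1) := by
      rw [pow_succ' E (n + 1)]; noncomm_ring
    rw [h3, ih, h2, hEF]
    push_cast
    have h4 : (n : A) * H = H * n := (Nat.cast_commute n H).eq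
    have : ((n : A) + 1) * (H - 2 - n) + H = (n + 1 + 1) * (H - (n + 1)) := by
      rw [← one_add_one_eq_two]
      simp only [mul_sub, add_mul, mul_add, one_mul, mul_one]
      abel
    rw [← this, add_mul _ H]

/-- The operator `H` has weights in `{0, 1, 2}` on the kernel of `E` if `E ^ 3 = 0`. -/
lemma poly_eq_mul (hE : E ^ 3 = 0) (hEF : E * F - F * E = H) (hHE : H * E - E * H = 2 * E) :
    6 • ((H - 2) * (H - 1) * H) =
      -((H - 2) * (3 * F * (F * E + 2 * H - 2) + 6 * (H - 1) * F)) * E := by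
  have h1 : E ^ 2 * F - F * E ^ 2 = 2 * (H - 1) * E := by
    linear_combination (norm := noncomm_ring) E * hEF + hEF * E - hHE
  have h2 : 3 * (H - 2) * E ^ 2 * F = 0 := by
    have h3 : E ^ 3 * F - F * E ^ 3 = 3 * (H - 2) * E ^ 2 := by
      linear_combination (norm := noncomm_ring) E * h1 + hEF * E ^ 2 - 2 * hHE * E
    rw [← h3, hE]
    simp
  linear_combination (norm := noncomm_ring) -(6 * (H - 2) * (H - 1) * hEF) - 3 * (H - 2) * h1 * F
    + h2 * F - 3 * (H - 2) * F * h1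

variable [Algebra ℂ A]

lemma eq_zero_of_nsmul_eq_zero_of_complex {n : ℕ} (hn : n ≠ 0) {a : A} (h : n • a = 0) :
    a = 0 := by
  rw [← Nat.cast_smul_eq_nsmul ℂ, smul_eq_zero] at h
  simpa [hn] using h

/-- The commutator of E ^ 3 = 0 with F is 3 E ^ 2 (H + 2): only weight -2 survives two raisings. -/
lemma sq_mul_add_two_eq_zero (hE : E ^ 3 = 0) (hEF : E * F - F * E = H)
    (hHE : H * E - E * H = 2 * E) : E ^ 2 * (H + 2) = 0 := by
  refine eq_zero_of_nsmul_eq_zero_of_complex (n := 3) (by norm_num) ?_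
  linear_combination (norm := noncomm_ring) hE * F - F * hE - E ^ 2 * hEF - E * hEF * E
    - hEF * E ^ 2 - hHE * E - 2 * E * hHE + 0 * hE

lemma mul_poly_eq_zero (hE : E ^ 3 = 0) (hEF : E * F - F * E = H)
    (hHE : H * E - E * H = 2 * E) (hHF : H * F - F * H = -(2 * F)) :
    E ^ 2 * F = E * (H + 1) * (H + 2) ∧ E * H * (H + 1) * (H + 2) = 0 := by
  have h1 := sq_mul_add_two_eq_zero hE hEF hHE
  have h2 : E ^ 2 * F = E * (H + 1) * (H + 2) := by
    have : 2 • (E ^ 2 * F - E * (H + 1) * (H + 2)) = 0 := by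
      linear_combination (norm := noncomm_ring) F * h1 - h1 * F + E * hEF * (H + 2)
        + hEF * E * (H + 2) + hHE * (H + 2) + E ^ 2 * hHF
    exact sub_eq_zero.mp (eq_zero_of_nsmul_eq_zero_of_complex two_ne_zero this)
  refine ⟨h2, ?_⟩
  linear_combination (norm := noncomm_ring) h1 * F - E ^ 2 * hHF - h2 * H

/-- Repeated commutation with F lowers the power of E until none is left. The roots are simple, so H
is diagonalizable with weights from -2 to 2. -/
lemma poly_eq_zero (hE : E ^ 3 = 0) (hEF : E * F - F * E = H)
    (hHE : H * E - E * H = 2 * E) (hHF : H * F - F * H = -(2 * F)) :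
    (H - 2) * (H - 1) * H * (H + 1) * (H + 2) = 0 := by
  obtain ⟨h1, h2⟩ := mul_poly_eq_zero hE hEF hHE hHF
  have h3 : E * F * (6 * H) = H * (H + 1) * (H + 2) := by
    linear_combination (norm := noncomm_ring) h1 * F - F * h1 - E * hEF * F - hEF * E * F
      - hHE * F - 2 * E * hHF + E * (H + 1) * hHF + E * hHF * H + hEF * (H + 1) * (H + 2)
  have h4 : E * F * H * (H - 1) * (H - 2) = 0 := by
    linear_combination (norm := noncomm_ring) h2 * F - E * H * (H + 1) * hHF - E * H * hHF * H
      - E * hHF * (H - 1) * H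
  have h5 : 6 • (E * F * H * (H - 1) * (H - 2)) = (H - 2) * (H - 1) * H * (H + 1) * (H + 2) := by
    linear_combination (norm := noncomm_ring) h3 * (H - 1) * (H - 2)
  rw [← h5, h4, smul_zero]

lemma eq_zero_of_forall_weight {S : A} (hH : (H - 2) * (H - 1) * H * (H + 1) * (H + 2) = 0)
    (hS : ∀ (k : ℤ) (X : A), H * X = k * X → S * X = 0) : S = 0 := by
  have h1 := hS 2 ((H - 1) * H * (H + 1) * (H + 2)) (by
    push_cast; linear_combination (norm := noncomm_ring) hH)
  have h2 := hS 1 ((H - 2) * H * (H + 1) * (H + 2)) (by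
    push_cast; linear_combination (norm := noncomm_ring) hH)
  have h3 := hS 0 ((H - 2) * (H - 1) * (H + 1) * (H + 2)) (by
    push_cast; linear_combination (norm := noncomm_ring) hH)
  have h4 := hS (-1) ((H - 2) * (H - 1) * H * (H + 2)) (by
    push_cast; linear_combination (norm := noncomm_ring) hH)
  have h5 := hS (-2) ((H - 2) * (H - 1) * H * (H + 1)) (by
    push_cast; linear_combination (norm := noncomm_ring) hH)
  -- Lagrange interpolation at -2, …, 2: the five cofactors with coefficients 1, -4, 6, -4, 1 sum to
  -- 4! = 24.
  refine eq_zero_of_nsmul_eq_zero_of_complex (n := 24) (by norm_num) ?_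
  linear_combination (norm := noncomm_ring) h1 - 4 * h2 + 6 * h3 - 4 * h4 + h5

/-- Moving E to the left shifts H by 2. This bounds the weights on im E, as `poly_eq_mul` does on
ker E. -/
lemma poly_mul_eq_zero (hE : E ^ 3 = 0) (hEF : E * F - F * E = H)
    (hHE : H * E - E * H = 2 * E) (hHF : H * F - F * H = -(2 * F)) :
    (H - 2) * (H - 1) * H * E = 0 := by
  obtain ⟨-, h⟩ := mul_poly_eq_zero hE hEF hHE hHF
  have h1 : H * E = E * (H + 2) := by linear_combination (norm := noncomm_ring) hHE
  have h2 : (H - 2) * (H - 1) * H * E = E * H * (H + 1) * (H + 2) := by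
    have h3 : (H - 2) * E = E * H := by linear_combination (norm := noncomm_ring) hHE
    have h4 : (H - 1) * E = E * (H + 1) := by linear_combination (norm := noncomm_ring) hHE
    rw [mul_assoc, h1, mul_assoc, ← mul_assoc (H - 1), h4, ← mul_assoc, ← mul_assoc, h3]
  rw [h2, h]

/-- If `A = E Z` with `E ^ 3 = 0` and `[E, [E, Z]] = 0`, then `A` is nilpotent. -/
lemma isNilpotent_mul_of_commutator {Z : A} (hE : E ^ 3 = 0)
    (hZ : E * (E * Z - Z * E) - (E * Z - Z * E) * E = 0) : IsNilpotent (E * Z) := by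
  have h1 : E ^ 2 * Z * E = 0 := by
    refine eq_zero_of_nsmul_eq_zero_of_complex (n := 3) (by norm_num) ?_
    linear_combination (norm := noncomm_ring) -(2 * E * hZ) - hZ * E + 2 * hE * Z + Z * hE
  have h2 : E * Z * E ^ 2 = 0 := by
    linear_combination (norm := noncomm_ring) E * hZ + 2 * h1 - hE * Z
  have h3 : (E * Z) ^ 4 = 0 := by
    refine eq_zero_of_nsmul_eq_zero_of_complex (n := 2) (by norm_num) ?_
    linear_combination (norm := noncomm_ring) -(E * Z * hZ * Z * E * Z) + h2 * Z ^ 2 * E * Z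
      + E * Z ^ 2 * h1 * Z
  exact ⟨4, h3⟩

end Ring

/-- Orthogonal projection onto D: an anisotropic form embeds D in its dual, and equality of
dimensions makes this onto. -/
lemma LinearMap.exists_mem_forall_apply_add_eq_zero {V : Type*} [AddCommGroup V] [Module ℝ V]
    (β : V →ₗ[ℝ] V →ₗ[ℝ] ℝ) (hβ : ∀ x, β x x = 0 → x = 0) (D : Submodule ℝ V)
    [FiniteDimensional ℝ D] (x : V) : ∃ d ∈ D, ∀ d' ∈ D, β d' (x + d) = 0 := by
  let Φ : D →ₗ[ℝ] Module.Dual ℝ D := (β.domRestrict₁₂ D D).flip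
  have hinj : Function.Injective Φ := by
    rw [← LinearMap.ker_eq_bot, LinearMap.ker_eq_bot']
    intro d hd
    exact Subtype.ext (hβ d (by simpa [Φ] using! congr($hd d)))
  have hsurj := (LinearMap.injective_iff_surjective_of_finrank_eq_finrank
    (Subspace.dual_finrank_eq (K := ℝ) (V := D)).symm).mp hinj
  obtain ⟨d, hd⟩ := hsurj (-((β.flip x).domRestrict D))
  refine ⟨d, d.2, fun d' hd' => ?_⟩
  have := congr($hd ⟨d', hd'⟩)
  rw [map_add, add_comm]
  exact add_eq_zero_iff_eq_neg.mpr this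

/-! ### Conjugation and definiteness on a compact real form -/

namespace IsCompactRealForm

variable {𝔤 : Type*} [LieRing 𝔤] [LieAlgebra ℂ 𝔤] {𝔨 : Submodule ℝ 𝔤}

lemma exists_add_I_smul (h𝔨 : IsCompactRealForm 𝔨) (x : 𝔤) :
    ∃ a ∈ 𝔨, ∃ b ∈ 𝔨, x = a + Complex.I • b := by
  have hx : x ∈ 𝔨 ⊔ Complex.I • 𝔨 := by rw [h𝔨.isCompl.sup_eq_top]; trivial
  obtain ⟨a, ha, c, hc, rfl⟩ := Submodule.mem_sup.mp hx
  obtain ⟨b, hb, rfl⟩ := Submodule.mem_smul_pointwise_iff_exists _ _ _ |>.mp hc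
  exact ⟨a, ha, b, hb, rfl⟩

/-- The conjugation of `𝔤` with respect to a real form `𝔨`: the real-linear map equal to the
identity on `𝔨` and to its negative on `i𝔨`. -/
noncomputable def conj (h𝔨 : IsCompactRealForm 𝔨) : 𝔤 →ₗ[ℝ] 𝔤 :=
  (2 : ℝ) • Submodule.projection 𝔨 (Complex.I • 𝔨) h𝔨.isCompl - LinearMap.id

variable (h𝔨 : IsCompactRealForm 𝔨)
include h𝔨

lemma conj_add_I_smul {a b : 𝔤} (ha : a ∈ 𝔨) (hb : b ∈ 𝔨) :
    h𝔨.conj (a + Complex.I • b) = a - Complex.I • b := by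
  have hb' : Complex.I • b ∈ Complex.I • 𝔨 := Submodule.smul_mem_pointwise_smul _ _ _ hb
  have h1 : Submodule.projection 𝔨 (Complex.I • 𝔨) h𝔨.isCompl a = a := by
    simpa using Submodule.projection_apply_left h𝔨.isCompl ⟨a, ha⟩
  have h2 : Submodule.projection 𝔨 (Complex.I • 𝔨) h𝔨.isCompl (Complex.I • b) = 0 := by
    simpa using Submodule.projection_apply_right h𝔨.isCompl ⟨_, hb'⟩
  simp only [conj, LinearMap.sub_apply, LinearMap.smul_apply, LinearMap.id_apply, map_add, h1, h2,
    smul_zero]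
  rw [two_smul]
  abel

lemma conj_lie (x y : 𝔤) : h𝔨.conj ⁅x, y⁆ = ⁅h𝔨.conj x, h𝔨.conj y⁆ := by
  obtain ⟨a, ha, b, hb, rfl⟩ := h𝔨.exists_add_I_smul x
  obtain ⟨c, hc, d, hd, rfl⟩ := h𝔨.exists_add_I_smul y
  have : ⁅a + Complex.I • b, c + Complex.I • d⁆
      = (⁅a, c⁆ - ⁅b, d⁆) + Complex.I • (⁅a, d⁆ + ⁅b, c⁆) := by
    simp only [add_lie, lie_add, smul_lie, lie_smul, smul_add]
    simp only [smul_smul, Complex.I_mul_I]; module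
  rw [this, h𝔨.conj_add_I_smul (sub_mem (h𝔨.lie_mem _ ha _ hc) (h𝔨.lie_mem _ hb _ hd))
    (add_mem (h𝔨.lie_mem _ ha _ hd) (h𝔨.lie_mem _ hb _ hc)), h𝔨.conj_add_I_smul ha hb,
    h𝔨.conj_add_I_smul hc hd]
  simp only [sub_lie, lie_sub, smul_lie, lie_smul, smul_sub, smul_add]
  simp only [smul_smul, Complex.I_mul_I]; module

lemma conj_conj (x : 𝔤) : h𝔨.conj (h𝔨.conj x) = x := by
  obtain ⟨a, ha, b, hb, rfl⟩ := h𝔨.exists_add_I_smul x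
  rw [h𝔨.conj_add_I_smul ha hb, sub_eq_add_neg, ← smul_neg, h𝔨.conj_add_I_smul ha (neg_mem hb)]
  simp

lemma mem_I_smul_of_conj_eq_neg {x : 𝔤} (hx : h𝔨.conj x = -x) : x ∈ Complex.I • 𝔨 := by
  obtain ⟨a, ha, b, hb, rfl⟩ := h𝔨.exists_add_I_smul x
  rw [h𝔨.conj_add_I_smul ha hb] at hx
  have h1 : (2 : ℂ) • a = 0 := by
    rw [two_smul]
    have h3 : a - Complex.I • b + (a + Complex.I • b) = 0 := by rw [hx]; abel
    rw [← h3]; abel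
  obtain rfl : a = 0 := by simpa using h1
  rw [zero_add]
  exact Submodule.smul_mem_pointwise_smul _ _ _ hb

lemma re_killingForm_self_le {a : 𝔤} (ha : a ∈ 𝔨) : (killingForm ℂ 𝔤 a a).re ≤ 0 := by
  rcases eq_or_ne a 0 with rfl | h
  · simp
  · exact (h𝔨.neg_def a ha h).le

/-- For x = a + ib the value is K(a, a) + K(b, b), a sum of two nonpositive terms. -/
lemma eq_zero_of_killingForm_conj {x : 𝔤} (hx : (killingForm ℂ 𝔤 x (h𝔨.conj x)).re = 0) :
    x = 0 := by
  obtain ⟨a, ha, b, hb, rfl⟩ := h𝔨.exists_add_I_smul x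
  rw [h𝔨.conj_add_I_smul ha hb] at hx
  have h1 : killingForm ℂ 𝔤 (a + Complex.I • b) (a - Complex.I • b)
      = killingForm ℂ 𝔤 a a + killingForm ℂ 𝔤 b b := by
    simp only [map_add, map_sub, LinearMap.add_apply, map_smul, LinearMap.smul_apply, smul_eq_mul]
    linear_combination Complex.I * LieModule.traceForm_comm ℂ 𝔤 𝔤 b a
      - killingForm ℂ 𝔤 b b * Complex.I_mul_I
  rw [h1, Complex.add_re] at hx
  have ha' := h𝔨.re_killingForm_self_le ha
  have hb' := h𝔨.re_killingForm_self_le hb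
  have h2 : a = 0 := by_contra fun h => by linarith [h𝔨.neg_def a ha h]
  have h3 : b = 0 := by_contra fun h => by linarith [h𝔨.neg_def b hb h]
  simp [h2, h3]

lemma eq_zero_of_mem_I_smul {x : 𝔤} (hx : x ∈ Complex.I • 𝔨) (h : killingForm ℂ 𝔤 x x = 0) :
    x = 0 := by
  obtain ⟨b, hb, rfl⟩ := Submodule.mem_smul_pointwise_iff_exists _ _ _ |>.mp hx
  have h1 : killingForm ℂ 𝔤 b b = 0 := by simpa using h
  have : b = 0 := by_contra fun h' => by simpa [h1] using h𝔨.neg_def b hb h'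
  simp [this]

lemma killingForm_nondegenerate : (killingForm ℂ 𝔤).Nondegenerate := by
  have h : ∀ x, (∀ y, killingForm ℂ 𝔤 x y = 0) → x = 0 := fun x hx =>
    h𝔨.eq_zero_of_killingForm_conj (by rw [hx]; rfl)
  refine ⟨h, fun x hx => h x fun y => ?_⟩
  rw [LieModule.traceForm_comm]
  exact hx y

lemma eq_zero_of_killingForm {x : 𝔤} (h : ∀ y, killingForm ℂ 𝔤 x y = 0) : x = 0 :=
  h𝔨.eq_zero_of_killingForm_conj (by rw [h]; rfl)

lemma orthogonal_orthogonal [FiniteDimensional ℂ 𝔤] (W : Submodule ℂ 𝔤) :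
    (killingForm ℂ 𝔤).orthogonal ((killingForm ℂ 𝔤).orthogonal W) = W :=
  LinearMap.BilinForm.orthogonal_orthogonal h𝔨.killingForm_nondegenerate
    (LieModule.traceForm_isSymm ℂ 𝔤 𝔤).isRefl W

end IsCompactRealForm

section MoorePenrose

variable {𝔤 : Type*} [LieRing 𝔤] [LieAlgebra ℂ 𝔤]

/-! ### Invariance of the Killing form, weights and Morozov's lemma -/

section KillingForm

lemma killingForm_lie_left (x y z : 𝔤) :
    killingForm ℂ 𝔤 ⁅x, y⁆ z = killingForm ℂ 𝔤 x ⁅y, z⁆ :=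
  LieModule.traceForm_apply_lie_apply ℂ 𝔤 𝔤 x y z

lemma killingForm_lie_left' (x y z : 𝔤) :
    killingForm ℂ 𝔤 ⁅x, y⁆ z = -killingForm ℂ 𝔤 y ⁅x, z⁆ := by
  rw [← lie_skew, map_neg, LinearMap.neg_apply, killingForm_lie_left]

lemma killingForm_symm (x y : 𝔤) : killingForm ℂ 𝔤 x y = killingForm ℂ 𝔤 y x :=
  LieModule.traceForm_comm ℂ 𝔤 𝔤 x y

lemma killingForm_eq_zero_of_weights {h x y : 𝔤} {a b : ℂ} (hx : ⁅h, x⁆ = a • x)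
    (hy : ⁅h, y⁆ = b • y) (hab : a + b ≠ 0) : killingForm ℂ 𝔤 x y = 0 := by
  have h1 := killingForm_lie_left' h x y
  rw [hx, hy, map_smul, map_smul, LinearMap.smul_apply, smul_eq_mul, smul_eq_mul] at h1
  have h2 : (a + b) * killingForm ℂ 𝔤 x y = 0 := by linear_combination h1
  simpa [hab] using h2

/-- An element of `im (ad e) ∩ ker (ad e)` is isotropic for the Killing form. -/
lemma killingForm_self_eq_zero {e z w : 𝔤} (hz : z = ⁅e, w⁆) (hez : ⁅e, z⁆ = 0) :
    killingForm ℂ 𝔤 z z = 0 := by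
  nth_rewrite 1 [hz]
  rw [killingForm_lie_left', hez, map_zero, neg_zero]

lemma ad_mul_sub_mul {x y z : 𝔤} (h : ⁅x, y⁆ = z) :
    LieAlgebra.ad ℂ 𝔤 x * LieAlgebra.ad ℂ 𝔤 y - LieAlgebra.ad ℂ 𝔤 y * LieAlgebra.ad ℂ 𝔤 x
      = LieAlgebra.ad ℂ 𝔤 z := by
  ext w
  simp [← h]

lemma ad_mul_sub_mul_eq_two_mul {h e : 𝔤} (hhe : ⁅h, e⁆ = (2 : ℂ) • e) :
    LieAlgebra.ad ℂ 𝔤 h * LieAlgebra.ad ℂ 𝔤 e - LieAlgebra.ad ℂ 𝔤 e * LieAlgebra.ad ℂ 𝔤 h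
      = 2 * LieAlgebra.ad ℂ 𝔤 e := by
  rw [ad_mul_sub_mul hhe, map_smul, two_smul, two_mul]

lemma ad_mul_sub_mul_eq_neg_two_mul {h f : 𝔤} (hhf : ⁅h, f⁆ = -((2 : ℂ) • f)) :
    LieAlgebra.ad ℂ 𝔤 h * LieAlgebra.ad ℂ 𝔤 f - LieAlgebra.ad ℂ 𝔤 f * LieAlgebra.ad ℂ 𝔤 h
      = -(2 * LieAlgebra.ad ℂ 𝔤 f) := by
  rw [ad_mul_sub_mul hhf, map_neg, map_smul, two_smul, two_mul]

/-- The operator `ad h` satisfies `(ad h - 2) (ad h - 1) (ad h) = 0` on the centralizer of `e`. -/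
lemma weights_of_lie_eq_zero {e h f z : 𝔤} (he : LieAlgebra.ad ℂ 𝔤 e ^ 3 = 0)
    (hef : ⁅e, f⁆ = h) (hhe : ⁅h, e⁆ = (2 : ℂ) • e) (hz : ⁅e, z⁆ = 0) :
    ((LieAlgebra.ad ℂ 𝔤 h - 2) * (LieAlgebra.ad ℂ 𝔤 h - 1) * LieAlgebra.ad ℂ 𝔤 h) z = 0 := by
  have h1 := congr($(poly_eq_mul he (ad_mul_sub_mul hef) (ad_mul_sub_mul_eq_two_mul hhe)) z)
  rw [Module.End.mul_apply (M := 𝔤) _ (LieAlgebra.ad ℂ 𝔤 e), LieAlgebra.ad_apply, hz,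
    map_zero, LinearMap.smul_apply, ← Nat.cast_smul_eq_nsmul ℂ, smul_eq_zero] at h1
  simpa using h1

/-- **Morozov's lemma** for an element with `(ad e) ^ 3 = 0`. -/
lemma exists_lie_eq_neg_two_smul {e h f : 𝔤} (he : LieAlgebra.ad ℂ 𝔤 e ^ 3 = 0)
    (hef : ⁅e, f⁆ = h) (hhe : ⁅h, e⁆ = (2 : ℂ) • e) :
    ∃ f', ⁅e, f'⁆ = h ∧ ⁅h, f'⁆ = -((2 : ℂ) • f') := by
  set w := ⁅h, f⁆ + (2 : ℂ) • f with hw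
  have hcomm : ∀ z : 𝔤, ⁅e, z⁆ = 0 → ⁅e, ⁅h, z⁆⁆ = 0 := fun z hz => by
    rw [leibniz_lie, hz, lie_zero, add_zero, ← lie_skew e h, hhe, neg_lie, smul_lie, hz, smul_zero,
      neg_zero]
  have hew : ⁅e, w⁆ = 0 := by
    rw [hw, lie_add, lie_smul, leibniz_lie, hef, lie_self, add_zero, ← lie_skew e h, hhe, neg_lie,
      smul_lie, hef]
    abel
  have hw3 := weights_of_lie_eq_zero he hef hhe hew
  -- This is (ad h + 2)⁻¹ w: modulo t(t - 1)(t - 2), the inverse of t + 2 is (t² - 5t + 12) / 24.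
  -- Subtracting z from f corrects its weight without changing [e, f].
  set z := (24 : ℂ)⁻¹ • (⁅h, ⁅h, w⁆⁆ - (5 : ℂ) • ⁅h, w⁆ + (12 : ℂ) • w) with hz
  have hez : ⁅e, z⁆ = 0 := by
    simp [hz, hew, hcomm]
  have hhz : ⁅h, z⁆ = w - (2 : ℂ) • z := by
    have h3 : ⁅h, ⁅h, ⁅h, w⁆⁆⁆ = (3 : ℂ) • ⁅h, ⁅h, w⁆⁆ - (2 : ℂ) • ⁅h, w⁆ := by
      have h4 : ((LieAlgebra.ad ℂ 𝔤 h - 2) * (LieAlgebra.ad ℂ 𝔤 h - 1) * LieAlgebra.ad ℂ 𝔤 h)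
          = LieAlgebra.ad ℂ 𝔤 h * LieAlgebra.ad ℂ 𝔤 h * LieAlgebra.ad ℂ 𝔤 h
            - (3 : ℂ) • (LieAlgebra.ad ℂ 𝔤 h * LieAlgebra.ad ℂ 𝔤 h)
            + (2 : ℂ) • LieAlgebra.ad ℂ 𝔤 h := by
        rw [← one_add_one_eq_two]
        simp only [sub_mul, mul_sub, add_mul, one_mul, mul_one]
        module
      rw [h4] at hw3
      simp only [LinearMap.add_apply, LinearMap.sub_apply, LinearMap.smul_apply,
        Module.End.mul_apply, LieAlgebra.ad_apply] at hw3
      rw [← sub_eq_zero, ← hw3]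
      module
    rw [hz]
    simp only [lie_smul, lie_add, lie_sub, h3]
    module
  refine ⟨f - z, by rw [lie_sub, hez, hef, sub_zero], ?_⟩
  rw [lie_sub, hhz, hw]
  module

end KillingForm

/-! ### Existence of a Hermitian characteristic when (ad e)³ = 0 -/

section FiniteDimensional

variable [FiniteDimensional ℂ 𝔤] {𝔨 : Submodule ℝ 𝔤} (h𝔨 : IsCompactRealForm 𝔨)
include h𝔨

/-- The first step of the **Jacobson–Morozov theorem** for an element with `(ad e) ^ 3 = 0`. -/
lemma exists_lie_lie_eq_self {e : 𝔤} (he : LieAlgebra.ad ℂ 𝔤 e ^ 3 = 0) :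
    ∃ y, ⁅e, ⁅e, y⁆⁆ = e := by
  -- The image of (ad e)² is the Killing orthogonal of its kernel; for z in that kernel, ad e · ad z
  -- is nilpotent and so has trace zero.
  suffices e ∈ LinearMap.range (LieAlgebra.ad ℂ 𝔤 e * LieAlgebra.ad ℂ 𝔤 e) by
    obtain ⟨y, hy⟩ := this
    exact ⟨y, hy⟩
  rw [← h𝔨.orthogonal_orthogonal (LinearMap.range _)]
  intro z hz
  have hz' : ⁅e, ⁅e, z⁆⁆ = 0 := by
    refine h𝔨.eq_zero_of_killingForm fun y => ?_
    have h1 : killingForm ℂ 𝔤 ⁅e, ⁅e, y⁆⁆ z = 0 := hz _ ⟨y, rfl⟩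
    rwa [killingForm_lie_left', killingForm_lie_left', neg_neg, killingForm_symm] at h1
  change killingForm ℂ 𝔤 z e = 0
  rw [killingForm_symm z e, killingForm_apply_apply]
  have h1 : IsNilpotent (LieAlgebra.ad ℂ 𝔤 e * LieAlgebra.ad ℂ 𝔤 z) := by
    refine isNilpotent_mul_of_commutator he ?_
    rw [ad_mul_sub_mul (rfl : ⁅e, z⁆ = _), ad_mul_sub_mul hz', map_zero]
  exact (LinearMap.isNilpotent_trace_of_isNilpotent h1).eq_zero

lemma range_ad_eq_orthogonal (e : 𝔤) :
    LinearMap.range (LieAlgebra.ad ℂ 𝔤 e)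
      = (killingForm ℂ 𝔤).orthogonal (LinearMap.ker (LieAlgebra.ad ℂ 𝔤 e)) := by
  rw [← h𝔨.orthogonal_orthogonal (LinearMap.range _)]
  congr 1
  ext z
  constructor
  · intro hz
    refine h𝔨.eq_zero_of_killingForm fun y => ?_
    have h1 : killingForm ℂ 𝔤 ⁅e, y⁆ z = 0 := hz _ ⟨y, rfl⟩
    rw [killingForm_lie_left', neg_eq_zero, killingForm_symm] at h1
    exact h1
  · rintro hz _ ⟨y, rfl⟩
    change killingForm ℂ 𝔤 ⁅e, y⁆ z = 0
    have hz' : ⁅e, z⁆ = 0 := hz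
    rw [killingForm_lie_left', hz', map_zero, neg_zero]

/-- Among the elements `h ∈ im (ad e)` with `[h, e] = 2e` there is one whose conjugate lies in
`ker (ad e) + im (ad e)`. -/
lemma exists_conj_mem_sup {e : 𝔤} (he : LieAlgebra.ad ℂ 𝔤 e ^ 3 = 0) :
    ∃ h f, ⁅e, f⁆ = h ∧ ⁅h, e⁆ = (2 : ℂ) • e ∧ h𝔨.conj h ∈
      LinearMap.ker (LieAlgebra.ad ℂ 𝔤 e) ⊔ LinearMap.range (LieAlgebra.ad ℂ 𝔤 e) := by
  set K := LinearMap.ker (LieAlgebra.ad ℂ 𝔤 e) ⊔ LinearMap.range (LieAlgebra.ad ℂ 𝔤 e) with hK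
  set D := (killingForm ℂ 𝔤).orthogonal K with hD
  obtain ⟨y, hy⟩ := exists_lie_lie_eq_self h𝔨 he
  let β : 𝔤 →ₗ[ℝ] 𝔤 →ₗ[ℝ] ℝ := LinearMap.mk₂ ℝ
    (fun a b => (killingForm ℂ 𝔤 a (h𝔨.conj b)).re) (by simp)
    (fun c a b => by rw [← Complex.coe_smul, map_smul]; simp) (by simp)
    (fun c a b => by rw [map_smul, ← Complex.coe_smul, map_smul]; simp)
  have hβ : ∀ x, β x x = 0 → x = 0 := fun x hx => h𝔨.eq_zero_of_killingForm_conj hx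
  -- The factor -2 gives [[e, -2y], e] = 2e. Since D = ker (ad e) ∩ im (ad e), adding d ∈ D keeps
  -- this relation and stays in im (ad e); d is chosen to make the sum orthogonal to D.
  obtain ⟨d, hd, hort⟩ := LinearMap.exists_mem_forall_apply_add_eq_zero β hβ
    (D.restrictScalars ℝ) (⁅e, (-2 : ℂ) • y⁆)
  have hdD : d ∈ D := hd
  have hed : ⁅e, d⁆ = 0 := by
    refine h𝔨.eq_zero_of_killingForm fun x => ?_
    have h1 : killingForm ℂ 𝔤 ⁅e, x⁆ d = 0 :=
      hdD _ (Submodule.mem_sup_right ⟨x, rfl⟩)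
    rwa [killingForm_lie_left', neg_eq_zero, killingForm_symm] at h1
  have hdr : d ∈ LinearMap.range (LieAlgebra.ad ℂ 𝔤 e) := by
    rw [range_ad_eq_orthogonal h𝔨]
    exact fun z hz => hdD z (Submodule.mem_sup_left hz)
  obtain ⟨y', rfl⟩ := hdr
  rw [LieAlgebra.ad_apply] at *
  refine ⟨_, (-2 : ℂ) • y + y', rfl, ?_, ?_⟩
  · rw [lie_add, add_lie, ← lie_skew _ e, ← lie_skew _ e, hed, lie_smul, lie_smul, hy]
    module
  · rw [← h𝔨.orthogonal_orthogonal K, lie_add]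
    intro d' hd'
    have h1 : (killingForm ℂ 𝔤 d' (h𝔨.conj (⁅e, (-2 : ℂ) • y⁆ + ⁅e, y'⁆))).re = 0 := hort d' hd'
    -- D is a complex subspace, so testing on i d' makes the imaginary part vanish too.
    have h2 : (killingForm ℂ 𝔤 (Complex.I • d')
        (h𝔨.conj (⁅e, (-2 : ℂ) • y⁆ + ⁅e, y'⁆))).re = 0 := hort _ (D.smul_mem Complex.I hd')
    rw [map_smul, LinearMap.smul_apply, smul_eq_mul, Complex.I_mul_re, neg_eq_zero] at h2
    exact Complex.ext h1 h2

/-- An element with `(ad e) ^ 3 = 0` has a Hermitian characteristic. -/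
lemma exists_isSl2Triple_mem_I_smul {e : 𝔤} (he0 : e ≠ 0) (he : LieAlgebra.ad ℂ 𝔤 e ^ 3 = 0) :
    ∃ h f, IsSl2Triple h e f ∧ h ∈ Complex.I • 𝔨 := by
  obtain ⟨h, f₀, hef₀, hhe, hc⟩ := exists_conj_mem_sup h𝔨 he
  obtain ⟨f, hef, hhf⟩ := exists_lie_eq_neg_two_smul he hef₀ hhe
  have h0 : h ≠ 0 := by
    rintro rfl
    rw [zero_lie] at hhe
    exact he0 (by simpa using hhe.symm)
  refine ⟨h, f, ⟨h0, hef, by rw [hhe, two_smul, two_smul], by rw [hhf, two_smul, two_smul]⟩,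
    h𝔨.mem_I_smul_of_conj_eq_neg ?_⟩
  have hEF := ad_mul_sub_mul hef
  have hHE := ad_mul_sub_mul_eq_two_mul hhe
  have hHF := ad_mul_sub_mul_eq_neg_two_mul hhf
  set H := LieAlgebra.ad ℂ 𝔤 h with hH
  set c := h𝔨.conj h with hc'
  have hc3 : ((H - 2) * (H - 1) * H) c = 0 := by
    obtain ⟨z, hz, _, ⟨y, rfl⟩, hzy⟩ := Submodule.mem_sup.mp hc
    rw [← hzy, map_add, weights_of_lie_eq_zero he hef hhe hz, zero_add,
      ← Module.End.mul_apply, poly_mul_eq_zero he hEF hHE hHF]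
    rfl
  have hhc : ⁅h, c⁆ = 0 := by
    -- The weight-0 part of c drops out, leaving v in weights 1 and 2; its components are isotropic
    -- and mutually orthogonal, whereas σv = -v.
    set v := ⁅h, c⁆ with hv
    have hv2 : ((H - 2) * (H - 1)) v = 0 := hc3
    have e2 : ∀ x, (2 : Module.End ℂ 𝔤) x = (2 : ℂ) • x := fun x => by
      rw [← one_add_one_eq_two, two_smul]; rfl
    simp only [Module.End.mul_apply, LinearMap.sub_apply, e2, Module.End.one_apply, hH,
      LieAlgebra.ad_apply, lie_sub] at hv2
    have hx2 : ⁅h, ⁅h, v⁆ - v⁆ = (2 : ℂ) • (⁅h, v⁆ - v) := by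
      rw [lie_sub]; exact sub_eq_zero.mp hv2
    have hx1 : ⁅h, ⁅h, v⁆ - (2 : ℂ) • v⁆ = (1 : ℂ) • (⁅h, v⁆ - (2 : ℂ) • v) := by
      rw [← sub_eq_zero, ← hv2, lie_sub, lie_smul]
      module
    have hvs : v = (⁅h, v⁆ - v) - (⁅h, v⁆ - (2 : ℂ) • v) := by module
    refine h𝔨.eq_zero_of_mem_I_smul (h𝔨.mem_I_smul_of_conj_eq_neg ?_) ?_
    · rw [hv, h𝔨.conj_lie, hc', h𝔨.conj_conj, lie_skew]
    · rw [hvs]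
      have hpq : ∀ p q : 𝔤, killingForm ℂ 𝔤 p p = 0 → killingForm ℂ 𝔤 p q = 0 →
          killingForm ℂ 𝔤 q q = 0 → killingForm ℂ 𝔤 (p - q) (p - q) = 0 := by
        intro p q h1 h2 h3
        simp [h1, h2, h3, killingForm_symm q p]
      exact hpq _ _ (killingForm_eq_zero_of_weights hx2 hx2 (by norm_num))
        (killingForm_eq_zero_of_weights hx2 hx1 (by norm_num))
        (killingForm_eq_zero_of_weights hx1 hx1 (by norm_num))
  -- The vector y = [c, x] + kx stays in the k-eigenspace of ad h, and σy is in that of ad c because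
  -- k is real. Invariance of K then gives K(y, σy) = 0.
  have hreal : ∀ (k : ℝ) (x : 𝔤), ⁅h, x⁆ = (k : ℂ) • x → ⁅c + h, x⁆ = 0 := by
    intro k x hx
    rw [add_lie, hx]
    set y := ⁅c, x⁆ + (k : ℂ) • x with hy
    have hhy : ⁅h, y⁆ = (k : ℂ) • y := by
      rw [hy, lie_add, leibniz_lie, hhc, zero_lie, zero_add, hx, lie_smul, lie_smul, hx, smul_add]
    have hcy : ⁅c, h𝔨.conj y⁆ = (k : ℂ) • h𝔨.conj y := by
      rw [hc', ← h𝔨.conj_lie, hhy, Complex.coe_smul, map_smul, Complex.coe_smul]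
    refine h𝔨.eq_zero_of_killingForm_conj ?_
    have : killingForm ℂ 𝔤 y (h𝔨.conj y) = 0 := by
      nth_rewrite 1 [hy]
      rw [map_add, LinearMap.add_apply, killingForm_lie_left', hcy, map_smul, map_smul]
      simp
    rw [this, Complex.zero_re]
  have hsum : c + h = 0 := by
    refine h𝔨.eq_zero_of_killingForm fun y => ?_
    have had : LieAlgebra.ad ℂ 𝔤 (c + h) = 0 := by
      refine eq_zero_of_forall_weight (poly_eq_zero he hEF hHE hHF) fun k X hX => ?_
      ext x
      refine hreal k (X x) ?_
      have := congr($hX x)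
      rw [Module.End.mul_apply, Module.End.mul_apply, Module.End.intCast_apply,
        ← Int.cast_smul_eq_zsmul ℂ] at this
      exact_mod_cast this
    rw [killingForm_apply_apply, had, LinearMap.zero_comp, map_zero]
  exact eq_neg_of_add_eq_zero_left hsum

end FiniteDimensional

/-! ### Uniqueness of the triple -/

section Uniqueness

/-- Otherwise f - f' would be a primitive vector of weight -2, but primitive vectors have weights in
ℕ. -/
lemma IsSl2Triple.eq_of_char_eq [FiniteDimensional ℂ 𝔤] {h e f f' : 𝔤}
    (t : IsSl2Triple h e f) (t' : IsSl2Triple h e f') : f = f' := by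
  by_contra hne
  have hp : t.HasPrimitiveVectorWith (f - f') (-2 : ℂ) := by
    refine ⟨sub_ne_zero.mpr hne, ?_, ?_⟩
    · rw [lie_sub, t.lie_lie_smul_f ℂ, t'.lie_lie_smul_f ℂ]
      module
    · rw [lie_sub, t.lie_e_f, t'.lie_e_f, sub_self]
  obtain ⟨n, hn⟩ := hp.exists_nat
  have := congr_arg Complex.re hn
  simp at this
  have : (0 : ℝ) ≤ n := n.cast_nonneg
  linarith

/-- The difference of two characteristics of `e` lies in `im (ad e) ∩ ker (ad e)`. -/
lemma IsSl2Triple.char_sub_char {L : Type*} [LieRing L] {h h' e f f' : L} (t : IsSl2Triple h e f)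
    (t' : IsSl2Triple h' e f') : h - h' = ⁅e, f - f'⁆ ∧ ⁅e, h - h'⁆ = 0 := by
  constructor
  · rw [lie_sub, t.lie_e_f, t'.lie_e_f]
  · rw [← lie_skew, sub_lie, t.lie_h_e_nsmul, t'.lie_h_e_nsmul, sub_self, neg_zero]

lemma IsSl2Triple.eq_of_mem_I_smul [FiniteDimensional ℂ 𝔤] {𝔨 : Submodule ℝ 𝔤}
    (h𝔨 : IsCompactRealForm 𝔨) {h h' e f f' : 𝔤} (t : IsSl2Triple h e f)
    (t' : IsSl2Triple h' e f') (hh : h ∈ Complex.I • 𝔨) (hh' : h' ∈ Complex.I • 𝔨) :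
    h = h' ∧ f = f' := by
  obtain ⟨h1, h2⟩ := t.char_sub_char t'
  obtain rfl : h = h' := sub_eq_zero.mp
    (h𝔨.eq_zero_of_mem_I_smul (sub_mem hh hh') (killingForm_self_eq_zero h1 h2))
  exact ⟨rfl, t.eq_of_char_eq t'⟩

end Uniqueness

/-! ### Transport along the orbit, and the bound on the height -/

section Orbit

lemma IsSl2Triple.map_adjointGroup [FiniteDimensional ℂ 𝔤] {g : 𝔤 ≃ₗ[ℂ] 𝔤}
    (hg : g ∈ adjointGroup 𝔤) {h e f : 𝔤} (t : IsSl2Triple h e f) :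
    IsSl2Triple (g h) (g e) (g f) where
  h_ne_zero := by simpa using t.h_ne_zero
  lie_e_f := by rw [← adjointGroup_map_lie hg, t.lie_e_f]
  lie_h_e_nsmul := by rw [← adjointGroup_map_lie hg, t.lie_h_e_nsmul, map_nsmul]
  lie_h_f_nsmul := by rw [← adjointGroup_map_lie hg, t.lie_h_f_nsmul, map_neg, map_nsmul]

lemma killingForm_adjointGroup [FiniteDimensional ℂ 𝔤] {g : 𝔤 ≃ₗ[ℂ] 𝔤}
    (hg : g ∈ adjointGroup 𝔤) (x y : 𝔤) :
    killingForm ℂ 𝔤 (g x) (g y) = killingForm ℂ 𝔤 x y :=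
  LieAlgebra.killingForm_of_equiv_apply
    { g with map_lie' := fun {a b} => adjointGroup_map_lie hg a b } x y

lemma ad_adjointGroup_pow [FiniteDimensional ℂ 𝔤] {g : 𝔤 ≃ₗ[ℂ] 𝔤}
    (hg : g ∈ adjointGroup 𝔤) (e x : 𝔤) (n : ℕ) :
    (LieAlgebra.ad ℂ 𝔤 (g e) ^ n) (g x) = g ((LieAlgebra.ad ℂ 𝔤 e ^ n) x) := by
  induction n with
  | zero => simp
  | succ n ih =>
    rw [pow_succ', pow_succ', Module.End.mul_apply, Module.End.mul_apply, ih,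
      LieAlgebra.ad_apply, LieAlgebra.ad_apply, adjointGroup_map_lie hg]

lemma IsNilpotentOrbit.exists_ad_pow_eq_zero [FiniteDimensional ℂ 𝔤] {O : Set 𝔤}
    (hO : IsNilpotentOrbit O) : ∃ n, ∀ e ∈ O, LieAlgebra.ad ℂ 𝔤 e ^ n = 0 := by
  obtain ⟨e₀, ⟨n, hn⟩, rfl⟩ := hO
  refine ⟨n, ?_⟩
  rintro _ ⟨⟨g, hg⟩, rfl⟩
  ext x
  obtain ⟨y, rfl⟩ := g.surjective x
  change (LieAlgebra.ad ℂ 𝔤 (g e₀) ^ n) (g y) = 0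
  rw [ad_adjointGroup_pow hg, hn]
  simp

lemma IsNilpotentOrbit.map_mem {O : Set 𝔤} (hO : IsNilpotentOrbit O) {e : 𝔤} (he : e ∈ O)
    {g : 𝔤 ≃ₗ[ℂ] 𝔤} (hg : g ∈ adjointGroup 𝔤) : g e ∈ O := by
  obtain ⟨e₀, -, rfl⟩ := hO
  exact (MulAction.mem_orbit_of_mem_orbit (⟨g, hg⟩ : adjointGroup 𝔤) he)

lemma IsNilpotentOrbit.nonempty {O : Set 𝔤} (hO : IsNilpotentOrbit O) : O.Nonempty := by
  obtain ⟨e₀, -, rfl⟩ := hO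
  exact ⟨e₀, MulAction.mem_orbit_self _⟩

lemma IsNilpotentOrbit.ne_zero {O : Set 𝔤} (hO : IsNilpotentOrbit O) (hO0 : O ≠ {0}) {e : 𝔤}
    (he : e ∈ O) : e ≠ 0 := by
  obtain ⟨e₀, -, rfl⟩ := hO
  rintro rfl
  apply hO0
  rw [← MulAction.orbit_eq_iff.mpr he]
  ext x
  simp only [MulAction.mem_orbit_iff, Set.mem_singleton_iff]
  constructor
  · rintro ⟨g, rfl⟩
    exact map_zero g.1
  · rintro rfl
    exact ⟨1, one_smul _ _⟩

lemma IsNilpotentOrbit.bddAbove [FiniteDimensional ℂ 𝔤] {O : Set 𝔤} (hO : IsNilpotentOrbit O) :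
    BddAbove {k : ℕ | ∃ e ∈ O, LieAlgebra.ad ℂ 𝔤 e ^ k ≠ 0} := by
  obtain ⟨n, hn⟩ := hO.exists_ad_pow_eq_zero
  refine ⟨n, ?_⟩
  rintro k ⟨e, he, hk⟩
  by_contra! hlt
  exact hk (pow_eq_zero_of_le hlt.le (hn e he))

/-- If every element of the orbit of `e` has a Hermitian characteristic then `(ad e) ^ 3 = 0`. -/
lemma IsMoorePenroseOrbit.ad_pow_three_eq_zero [FiniteDimensional ℂ 𝔤] {𝔨 : Submodule ℝ 𝔤}
    (h𝔨 : IsCompactRealForm 𝔨) {O : Set 𝔤} (hO : IsNilpotentOrbit O)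
    (hMP : IsMoorePenroseOrbit 𝔨 O) {e : 𝔤} (he : e ∈ O) : LieAlgebra.ad ℂ 𝔤 e ^ 3 = 0 := by
  by_contra h3
  obtain ⟨h, f, t, hh⟩ := hMP e he
  obtain ⟨n, hn3, hn, hn1⟩ : ∃ n, 3 ≤ n ∧ LieAlgebra.ad ℂ 𝔤 e ^ n ≠ 0 ∧
      LieAlgebra.ad ℂ 𝔤 e ^ (n + 1) = 0 := by
    have hnil : IsNilpotent (LieAlgebra.ad ℂ 𝔤 e) :=
      hO.exists_ad_pow_eq_zero.imp fun _ hm => hm e he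
    have := nontrivial_of_ne _ _ h3
    have hpos : 3 < nilpotencyClass (LieAlgebra.ad ℂ 𝔤 e) := by
      by_contra! hle
      exact h3 (pow_eq_zero_of_le hle (pow_nilpotencyClass hnil))
    refine ⟨nilpotencyClass (LieAlgebra.ad ℂ 𝔤 e) - 1, by omega,
      pow_pred_nilpotencyClass hnil, ?_⟩
    rw [Nat.sub_add_cancel (by omega)]
    exact pow_nilpotencyClass hnil
  obtain ⟨y, hy⟩ : ∃ y, (LieAlgebra.ad ℂ 𝔤 e ^ n) y ≠ 0 := by
    by_contra! h0
    exact hn (LinearMap.ext h0)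
  set u := (LieAlgebra.ad ℂ 𝔤 e ^ n) y with hu
  have heu : ⁅e, u⁆ = 0 := by
    rw [hu, ← LieAlgebra.ad_apply ℂ, ← Module.End.mul_apply, ← pow_succ', hn1]
    rfl
  -- Since (ad e) ^ (n + 1) = 0, its commutator with ad f vanishes, leaving (n + 1)(ad h - n)(ad e)
  -- ^ n = 0.
  have hhu : ⁅h, u⁆ = (n : ℂ) • u := by
    have h1 := pow_succ_mul_of_sl2_relations (ad_mul_sub_mul t.lie_e_f)
      (ad_mul_sub_mul_eq_two_mul (t.lie_h_e_smul ℂ)) n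
    rw [hn1, zero_mul, mul_zero, sub_zero] at h1
    have h2 := congr($h1.symm y)
    have h3 : ((n : Module.End ℂ 𝔤) + 1) * (LieAlgebra.ad ℂ 𝔤 h - n)
        = ((n : ℂ) + 1) • (LieAlgebra.ad ℂ 𝔤 h - (n : ℂ) • 1) := by
      rw [add_smul, one_smul, add_mul, one_mul, Nat.cast_smul_eq_nsmul,
        Nat.cast_smul_eq_nsmul, nsmul_eq_mul, nsmul_eq_mul, mul_one]
    rw [h3, Module.End.mul_apply, ← hu, LinearMap.smul_apply, LinearMap.zero_apply,
      smul_eq_zero] at h2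
    have h4 : (n : ℂ) + 1 ≠ 0 := by exact_mod_cast n.succ_ne_zero
    simpa [h4, sub_eq_zero] using h2
  set x := ⁅f, u⁆ with hx
  have hhx : ⁅h, x⁆ = ((n : ℂ) - 2) • x := by
    rw [hx, leibniz_lie, t.lie_lie_smul_f ℂ, hhu, neg_lie, smul_lie, lie_smul]
    module
  have hex : ⁅e, x⁆ = (n : ℂ) • u := by
    rw [hx, leibniz_lie, t.lie_e_f, heu, lie_zero, add_zero, hhu]
  have hn0 : (n : ℂ) ≠ 0 := by exact_mod_cast (by omega : n ≠ 0)
  have hex0 : ⁅e, x⁆ ≠ 0 := by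
    rw [hex]
    exact smul_ne_zero hn0 hy
  have hk : (n : ℂ) - 2 ≠ 0 := by
    rw [sub_ne_zero]
    exact_mod_cast (by omega : n ≠ 2)
  have hxrange : ∃ w, x = ⁅e, w⁆ := by
    have h1 : ⁅e, ⁅f, x⁆⁆ = (2 * (n : ℂ) - 2) • x := by
      rw [leibniz_lie, t.lie_e_f, hhx, hex, lie_smul, ← hx]
      module
    have h2 : 2 * (n : ℂ) - 2 ≠ 0 := by
      rw [sub_ne_zero]
      exact_mod_cast (by omega : 2 * n ≠ 2)
    exact ⟨(2 * (n : ℂ) - 2)⁻¹ • ⁅f, x⁆, by rw [lie_smul, h1, smul_smul, inv_mul_cancel₀ h2,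
      one_smul]⟩
  obtain ⟨w, hw⟩ := hxrange
  obtain ⟨N, hN⟩ := Module.End.isNilpotent_of_commutator_eq_smul hk
    (H := LieAlgebra.ad ℂ 𝔤 h) (X := LieAlgebra.ad ℂ 𝔤 x) (by rw [ad_mul_sub_mul hhx, map_smul])
  -- The extra 2 lets the terms of degree 0 and 1 be split off; on h all later ones vanish.
  have hN2 : LieAlgebra.ad ℂ 𝔤 x ^ (N + 2) = 0 := by rw [pow_add, hN, zero_mul]
  obtain ⟨g, hg, hgexp⟩ := exists_mem_adjointGroup_exp hN2
  have hxh : ⁅x, h⁆ = -(((n : ℂ) - 2) • x) := by rw [← lie_skew, hhx]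
  have hgx : g x = x := by
    rw [hgexp, Finset.sum_eq_single 0]
    · simp
    · intro i _ hi
      obtain ⟨j, rfl⟩ := Nat.exists_eq_succ_of_ne_zero hi
      simp [pow_succ]
    · simp
  have hgh : g h = h - ((n : ℂ) - 2) • x := by
    rw [hgexp, Finset.sum_range_succ', Finset.sum_range_succ', Finset.sum_eq_zero]
    · simp [hxh]
      abel
    · intro i _
      simp [pow_succ, hxh]
  obtain ⟨h', f', t', hh'⟩ := hMP (g e) (hO.map_mem he hg)
  obtain ⟨z₁, hz₁⟩ := g.surjective (h' - g h)
  obtain ⟨w₁, hw₁⟩ := g.surjective (f' - g f)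
  obtain ⟨h1, h2⟩ := t'.char_sub_char (t.map_adjointGroup hg)
  rw [← hz₁, ← hw₁, ← adjointGroup_map_lie hg] at h1
  rw [← hz₁, ← adjointGroup_map_lie hg, map_eq_zero_iff g g.injective] at h2
  replace h1 := g.injective h1
  have hzz : killingForm ℂ 𝔤 (g z₁) (g z₁) = 0 := by
    rw [killingForm_adjointGroup hg, killingForm_self_eq_zero h1 h2]
  have hzx : killingForm ℂ 𝔤 x (g z₁) = 0 := by
    rw [← hgx, killingForm_adjointGroup hg, hw, killingForm_lie_left', h2, map_zero, neg_zero]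
  have hxx : killingForm ℂ 𝔤 x x = 0 :=
    killingForm_eq_zero_of_weights hhx hhx (by rw [← two_mul]; exact mul_ne_zero two_ne_zero hk)
  have hdiff : h' - h = g z₁ - ((n : ℂ) - 2) • x := by rw [hz₁, hgh]; abel
  -- Both g z₁ and x are isotropic. They are orthogonal because g fixes x, while x ∈ im (ad e) and
  -- z₁ ∈ ker (ad e).
  have h0 : h' - h = 0 := by
    refine h𝔨.eq_zero_of_mem_I_smul (sub_mem hh' hh) ?_
    rw [hdiff]
    simp only [map_sub, LinearMap.sub_apply, map_smul, LinearMap.smul_apply, hzz, hxx, hzx,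
      killingForm_symm (g z₁) x]
    simp
  have h5 : z₁ = ((n : ℂ) - 2) • x := by
    apply g.injective
    rw [map_smul, hgx, ← sub_eq_zero, ← hdiff, h0]
  rw [h5, lie_smul] at h2
  exact hex0 ((smul_eq_zero.mp h2).resolve_left hk)

end Orbit

end MoorePenrose

theorem theorem4p23 {𝔤 : Type*} [LieRing 𝔤] [LieAlgebra ℂ 𝔤] [FiniteDimensional ℂ 𝔤]
    [LieAlgebra.IsSimple ℂ 𝔤] (𝔨 : Submodule ℝ 𝔤) (h𝔨 : IsCompactRealForm 𝔨)
    (O : Set 𝔤) (hO : IsNilpotentOrbit O) (hO0 : O ≠ {0}) :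
    (IsMoorePenroseOrbit 𝔨 O ↔ orbitHeight O = 2) ∧
      (IsMoorePenroseOrbit 𝔨 O →
        ∀ e ∈ O, ∃! p : 𝔤 × 𝔤, IsSl2Triple p.1 e p.2 ∧ p.1 ∈ Complex.I • 𝔨) := by
  refine ⟨⟨fun hMP => ?_, fun hht e he => ?_⟩, fun hMP e he => ?_⟩
  · refine IsGreatest.csSup_eq ⟨?_, ?_⟩
    · obtain ⟨e, he⟩ := hO.nonempty
      obtain ⟨h, f, t, -⟩ := hMP e he
      refine ⟨e, he, fun h0 => t.e_ne_zero ?_⟩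
      -- Here (ad e)² f = [e, h] = -2e, which is nonzero.
      have h1 := congr($h0 f)
      rw [sq, Module.End.mul_apply, LieAlgebra.ad_apply, LieAlgebra.ad_apply, t.lie_e_f,
        ← lie_skew, t.lie_h_e_smul ℂ] at h1
      simpa using h1
    · rintro k ⟨e, he, hk⟩
      by_contra! hlt
      exact hk (pow_eq_zero_of_le hlt (hMP.ad_pow_three_eq_zero h𝔨 hO he))
  · refine exists_isSl2Triple_mem_I_smul h𝔨 (hO.ne_zero hO0 he) ?_
    by_contra h3
    have h4 : 3 ≤ orbitHeight O := le_csSup hO.bddAbove ⟨e, he, h3⟩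
    omega
  · obtain ⟨h, f, t, hh⟩ := hMP e he
    refine ⟨(h, f), ⟨t, hh⟩, ?_⟩
    rintro ⟨h', f'⟩ ⟨t', hh'⟩
    obtain ⟨h1, h2⟩ := IsSl2Triple.eq_of_mem_I_smul h𝔨 t' t hh' hh
    exact Prod.ext h1 h2
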